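/- Let $d\ge 0$. The matrix universe over $\mathbb C^d$ is $\mathcal M(\mathbb C^d)=\bigsqcup_{n\ge1}M_n(\mathbb C)^d$. For $D\subseteq\mathcal M(\mathbb C^d)$ write $D_n=D\cap M_n(\mathbb C)^d$. Direct sums and products with a matrix are taken entrywise on tuples. The set $D$ is a free set if $X\oplus Y\in D$ whenever $X,Y\in D$, and $V^*XV\in D$ whenever $X\in D_n$ and $V$ is an $n\times n$ unitary; it is open if every $D_n$ is open, and connected if any two points of each $D_n$ are joined by a path in $D_n$. A free function $F:D\to\mathcal M(\mathbb C^d)$ on a free set $D$ is a map that sends $D_n$ into $M_n(\mathbb C)^d$ for each $n$ and satisfies $F(X\oplus Y)=F(X)\oplus F(Y)$ and $F(V^*XV)=V^*F(X)V$ for $X,Y\in D$ and every unitary $V$ of the size of $X$; on an open free set it is analytic if each restriction $F|_{D_n}$ is complex analytic. Its derivative at $X\in D_n$ in the direction $H\in M_n(\mathbb C)^d$ is $DF(X)[H]=\frac{d}{dz}F(X+zH)\big|_{z=0}$, $z\in\mathbb C$. **Theorem (free inverse function theorem).** Let $U\subseteq\mathcal M(\mathbb C^d)$ be an open connected free set and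 let $F:U\to\mathcal M(\mathbb C^d)$ be an analytic free function. The following are equivalent: 1. $DF(X)$ is nonsingular for every $X\in U$; that is, for every $n$ and every $X\in U_n$ the map $H\mapsto DF(X)[H]$ is a bijection of $M_n(\mathbb C)^d$ onto itself. 2. $F^{-1}$ exists on the range of $F$ and is an analytic free function; that is, $F(U)$ is an open free set, and there is an analytic free function $G:F(U)\to\mathcal M(\mathbb C^d)$ such that $G(F(X))=X$ for all $X\in U$ and $F(G(Y))=Y$ for all $Y\in F(U)$. -/

import Mathlib

open scoped Matrix Matrix.Norms.Elementwise

namespace FreeAnalysis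

/-- Level `n` of the matrix universe over `ℂ^d`: the space `M_n(ℂ) ⊗ ℂ^d` of `d`-tuples of complex
`n × n` matrices. It is finite dimensional, so its topology and analytic functions do not depend on
the norm; the entrywise supremum norm is used. -/
abbrev MatTuple (d : ℕ) (n : ℕ+) : Type := Fin d → Matrix (Fin n) (Fin n) ℂ

/-- The direct sum `X ⊕ Y` of two `d`-tuples of matrices, taken entry by entry: the block diagonal
matrices with blocks `X i` and `Y i`. -/
def directSum {d : ℕ} {m n : ℕ+} (X : MatTuple d m) (Y : MatTuple d n) : MatTuple d (m + n) :=
  let e : Fin m ⊕ Fin n ≃ Fin (m + n : ℕ+) :=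
    finSumFinEquiv.trans (finCongr (PNat.add_coe m n).symm)
  fun i => Matrix.reindex e e (Matrix.fromBlocks (X i) 0 0 (Y i))

/-- The conjugate `V* X V` of a `d`-tuple of matrices, taken entry by entry. -/
def conj {d : ℕ} {n : ℕ+} (V : Matrix (Fin n) (Fin n) ℂ) (X : MatTuple d n) : MatTuple d n :=
  fun i => Vᴴ * X i * V

/-- A subset of the matrix universe over `ℂ^d` (the disjoint union over `n ≥ 1` of the levels),
given by its levels `D n`. -/
abbrev USet (d : ℕ) : Type := ∀ n : ℕ+, Set (MatTuple d n)

/-- A graded map from the matrix universe over `ℂ^d` to that over `ℂ^e`, given by its levels.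
Only the values on the domain under consideration matter. -/
abbrev UMap (d e : ℕ) : Type := ∀ n : ℕ+, MatTuple d n → MatTuple e n

/-- A free set: closed under direct sums and under conjugation by unitaries. -/
structure IsFreeSet {d : ℕ} (D : USet d) : Prop where
  directSum_mem : ∀ (m n : ℕ+) (X : MatTuple d m) (Y : MatTuple d n),
    X ∈ D m → Y ∈ D n → directSum X Y ∈ D (m + n)
  conj_mem : ∀ (n : ℕ+) (X : MatTuple d n) (V : Matrix (Fin n) (Fin n) ℂ),
    V ∈ Matrix.unitaryGroup (Fin n) ℂ → X ∈ D n → conj V X ∈ D n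

/-- Openness: each level is open. -/
def IsOpenLevels {d : ℕ} (D : USet d) : Prop := ∀ n : ℕ+, IsOpen (D n)

/-- Connectedness: each level is path connected (a level may be empty). -/
def IsConnectedLevels {d : ℕ} (D : USet d) : Prop :=
  ∀ (n : ℕ+) (X Y : MatTuple d n), X ∈ D n → Y ∈ D n → JoinedIn (D n) X Y

/-- `F` restricts to a free function on `D`: it respects direct sums and conjugation by unitaries
(and it is graded, by its type). -/
structure IsFreeFunction {d e : ℕ} (D : USet d) (F : UMap d e) : Prop where
  map_directSum : ∀ (m n : ℕ+) (X : MatTuple d m) (Y : MatTuple d n),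
    X ∈ D m → Y ∈ D n → F (m + n) (directSum X Y) = directSum (F m X) (F n Y)
  map_conj : ∀ (n : ℕ+) (X : MatTuple d n) (V : Matrix (Fin n) (Fin n) ℂ),
    V ∈ Matrix.unitaryGroup (Fin n) ℂ → X ∈ D n → F n (conj V X) = conj V (F n X)

/-- An analytic free function on `D`: a free function each level of which is complex analytic. -/
structure IsAnalyticFreeFunction {d e : ℕ} (D : USet d) (F : UMap d e) : Prop
    extends IsFreeFunction D F where
  analytic : ∀ n : ℕ+, AnalyticOnNhd ℂ (F n) (D n)

/-- The derivative `DF(X)[H]`: the complex derivative at `z = 0` of `F(X + zH)`. -/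
noncomputable def freeDeriv {d e : ℕ} (F : UMap d e) {n : ℕ+} (X H : MatTuple d n) :
    MatTuple e n :=
  deriv (fun z : ℂ => F n (X + z • H)) 0

/-- The range `F(D)`, level by level. -/
def image {d e : ℕ} (F : UMap d e) (D : USet d) : USet e := fun n => F n '' D n

/-- `F⁻¹` exists on the range `F(D)` and is an analytic free function there: `F(D)` is an open free
set, and some analytic free function `G` on `F(D)` is a two-sided inverse of `F : D → F(D)`. -/
def HasAnalyticFreeInverse {d e : ℕ} (D : USet d) (F : UMap d e) : Prop :=
  IsFreeSet (image F D) ∧ IsOpenLevels (image F D) ∧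
    ∃ G : UMap e d, IsAnalyticFreeFunction (image F D) G ∧
      ∀ n : ℕ+, Set.InvOn (G n) (F n) (D n) (image F D n)

end FreeAnalysis

/-! The substance is that injective derivatives force `F` to be injective on each level.
Differentiating unitary covariance along a one-parameter unitary group with generator `K` gives
`DF(X)[XK - KX] = F(X)K - KF(X)` (`fderiv_commutator`). At `X ⊕ Y`, complex linearity combines two
such identities into one for the nilpotent generator `2E₁₂`: the off-diagonal direction `2(X - Y)`
is sent to `2(F(X) - F(Y))` (`fderiv_directSum_offDiag`). If `F(X) = F(Y)`, that direction lies in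
the kernel at `X ⊕ Y`, so `X = Y`. The classical inverse function theorem on each level then makes
the range open and the inverse analytic; freeness of the inverse is formal. The converse is the
chain rule. -/

namespace FreeAnalysis

open Filter Topology

section InverseFunction

variable {E : Type*} [NormedAddCommGroup E] [NormedSpace ℂ E] [FiniteDimensional ℂ E]

/-- An injective analytic map with bijective derivatives has open range, and any left inverse
of it is analytic on the range. -/
theorem isOpen_image_and_analyticOnNhd_leftInvOn {f g : E → E} {s : Set E} (hs : IsOpen s)
    (hf : AnalyticOnNhd ℂ f s) (hf' : ∀ x ∈ s, Function.Bijective (fderiv ℂ f x))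
    (hg : Set.LeftInvOn g f s) :
    IsOpen (f '' s) ∧ AnalyticOnNhd ℂ g (f '' s) := by
  have : CompleteSpace E := FiniteDimensional.complete ℂ E
  have equiv : ∀ x ∈ s, ∃ f' : E ≃L[ℂ] E, HasFDerivAt f (f' : E →L[ℂ] E) x := fun x hx =>
    ⟨(LinearEquiv.ofBijective (fderiv ℂ f x : E →ₗ[ℂ] E) (hf' x hx)).toContinuousLinearEquiv,
      by convert! (hf x hx).differentiableAt.hasFDerivAt⟩
  constructor
  · rw [isOpen_iff_mem_nhds]
    rintro _ ⟨x, hx, rfl⟩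
    obtain ⟨f', h'⟩ := equiv x hx
    have hstrict := (hf x hx).contDiffAt (n := 1) |>.hasStrictFDerivAt' h' one_ne_zero
    rw [← hstrict.map_nhds_eq_of_equiv]
    exact image_mem_map (hs.mem_nhds hx)
  · rintro _ ⟨x, hx, rfl⟩
    obtain ⟨f', h'⟩ := equiv x hx
    have hc : ContDiffAt ℂ ⊤ f x := (hf x hx).contDiffAt
    have hl := (hc.to_localInverse h' (by simp)).analyticAt
    have hstrict := hc.hasStrictFDerivAt' h' (by simp)
    refine hl.congr ?_
    -- Neighbourhoods of `f x` are generated by images of neighbourhoods of `x`, so the local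
    -- inverse and `g` need only be compared at points `f y`.
    rw [EventuallyEq, ← hstrict.map_nhds_eq_of_equiv, eventually_map]
    filter_upwards [hstrict.eventually_left_inverse, hs.mem_nhds hx] with y hy hys
    exact hy.trans (hg hys).symm

end InverseFunction

variable {d e : ℕ}

theorem freeDeriv_eq_fderiv {F : UMap d e} {n : ℕ+} {X : MatTuple d n}
    (hF : DifferentiableAt ℂ (F n) X) (H : MatTuple d n) :
    freeDeriv F X H = fderiv ℂ (F n) X H := by
  have h : HasDerivAt (fun z : ℂ => X + z • H) H 0 := by
    convert! ((hasDerivAt_id (0 : ℂ)).smul_const H).const_add X using 1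
    simp
  have hF' : HasFDerivAt (F n) (fderiv ℂ (F n) X) (X + (0 : ℂ) • H) := by
    simpa using hF.hasFDerivAt
  exact (hF'.comp_hasDerivAt (0 : ℂ) h).deriv

/-- The entrywise commutator `X K - K X` of a tuple with a matrix. -/
def commutator {n : ℕ+} (X : MatTuple d n) (K : Matrix (Fin n) (Fin n) ℂ) : MatTuple d n :=
  fun i => X i * K - K * X i

/-- Since `K² = -1`, this matrix is `exp(tK)`, in a form that needs no matrix exponential. -/
theorem cos_sin_mem_unitaryGroup {n : ℕ+} {K : Matrix (Fin n) (Fin n) ℂ}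
    (hK : Kᴴ = -K) (hKK : K * K = -1) (t : ℝ) :
    ((Real.cos t : ℂ) • (1 : Matrix (Fin n) (Fin n) ℂ) + (Real.sin t : ℂ) • K) ∈
      Matrix.unitaryGroup (Fin n) ℂ := by
  rw [Matrix.mem_unitaryGroup_iff', Matrix.star_eq_conjTranspose, Matrix.conjTranspose_add,
    Matrix.conjTranspose_smul, Matrix.conjTranspose_smul, hK, Matrix.conjTranspose_one]
  have h : (Real.cos t : ℂ) * Real.cos t + (Real.sin t : ℂ) * Real.sin t = 1 := by
    exact_mod_cast by nlinarith [Real.sin_sq_add_cos_sq t]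
  simp only [Complex.star_def, Complex.conj_ofReal, add_mul, mul_add, smul_mul_assoc,
    mul_smul_comm, one_mul, mul_one, neg_mul, smul_neg, hKK, neg_neg]
  calc _ = ((Real.cos t : ℂ) * Real.cos t + (Real.sin t : ℂ) * Real.sin t) •
        (1 : Matrix (Fin n) (Fin n) ℂ) := by module
    _ = 1 := by rw [h, one_smul]

/-- Of the coefficients `cos²`, `cos · sin` and `sin²`, only the middle one has nonzero derivative
at `0`. -/
theorem hasDerivAt_conj_cos_sin {n : ℕ+} {K : Matrix (Fin n) (Fin n) ℂ}
    (hK : Kᴴ = -K) (X : MatTuple d n) :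
    HasDerivAt (fun t : ℝ => conj ((Real.cos t : ℂ) • (1 : Matrix (Fin n) (Fin n) ℂ) +
      (Real.sin t : ℂ) • K) X) (commutator X K) 0 := by
  have expand : (fun t : ℝ => conj ((Real.cos t : ℂ) • (1 : Matrix (Fin n) (Fin n) ℂ) +
      (Real.sin t : ℂ) • K) X) = fun t : ℝ => (Real.cos t * Real.cos t) • X +
        (Real.cos t * Real.sin t) • commutator X K -
        (Real.sin t * Real.sin t) • (fun i => K * X i * K : MatTuple d n) := by
    funext t i
    simp only [conj, commutator, Matrix.conjTranspose_add, Matrix.conjTranspose_smul, hK,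
      Matrix.conjTranspose_one, Complex.star_def, Complex.conj_ofReal, add_mul, mul_add,
      smul_mul_assoc, mul_smul_comm, one_mul, mul_one, neg_mul, smul_neg,
      Pi.add_apply, Pi.sub_apply, Pi.smul_apply, ← Complex.coe_smul, Complex.ofReal_mul]
    module
  rw [expand]
  have hc := Real.hasDerivAt_cos 0
  have hs := Real.hasDerivAt_sin 0
  have := (((hc.mul hc).smul_const X).add ((hc.mul hs).smul_const (commutator X K))).sub
    ((hs.mul hs).smul_const (fun i => K * X i * K : MatTuple d n))
  convert! this using 1
  simp

/-- The derivative of a free function carries commutators to commutators. -/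
theorem fderiv_commutator {D : USet d} {F : UMap d e} (hF : IsFreeFunction D F) {n : ℕ+}
    {X : MatTuple d n} (hX : X ∈ D n) (hd : DifferentiableAt ℂ (F n) X)
    {K : Matrix (Fin n) (Fin n) ℂ} (hK : Kᴴ = -K) (hKK : K * K = -1) :
    fderiv ℂ (F n) X (commutator X K) = commutator (F n X) K := by
  have h0 : conj ((Real.cos 0 : ℂ) • (1 : Matrix (Fin n) (Fin n) ℂ) + (Real.sin 0 : ℂ) • K) X
      = X := by
    funext i; simp [conj]
  -- The path is unitary only for real `t`, so the chain rule is applied over `ℝ`.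
  have hd' : HasFDerivAt (F n) ((fderiv ℂ (F n) X).restrictScalars ℝ)
      (conj ((Real.cos 0 : ℂ) • (1 : Matrix (Fin n) (Fin n) ℂ) + (Real.sin 0 : ℂ) • K) X) := by
    rw [h0]; exact hd.hasFDerivAt.restrictScalars ℝ
  have h1 := hd'.comp_hasDerivAt (0 : ℝ) (hasDerivAt_conj_cos_sin hK X)
  have h2 := hasDerivAt_conj_cos_sin hK (F n X)
  refine h1.unique (h2.congr_of_eventuallyEq (Eventually.of_forall fun t => ?_))
  exact hF.map_conj n X _ (cos_sin_mem_unitaryGroup hK hKK t) hX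

/-- The block matrix of size `m + n` with the given blocks, indexed as in `directSum`. -/
def block {m n : ℕ+} (A : Matrix (Fin m) (Fin m) ℂ) (B : Matrix (Fin m) (Fin n) ℂ)
    (C : Matrix (Fin n) (Fin m) ℂ) (D : Matrix (Fin n) (Fin n) ℂ) :
    Matrix (Fin (m + n : ℕ+)) (Fin (m + n : ℕ+)) ℂ :=
  let e : Fin m ⊕ Fin n ≃ Fin (m + n : ℕ+) :=
    finSumFinEquiv.trans (finCongr (PNat.add_coe m n).symm)
  Matrix.reindex e e (Matrix.fromBlocks A B C D)

theorem directSum_apply {m n : ℕ+} (X : MatTuple d m) (Y : MatTuple d n) (i : Fin d) :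
    directSum X Y i = block (X i) 0 0 (Y i) := rfl

section Block

variable {m n : ℕ+} (A A' : Matrix (Fin m) (Fin m) ℂ) (B B' : Matrix (Fin m) (Fin n) ℂ)
  (C C' : Matrix (Fin n) (Fin m) ℂ) (D D' : Matrix (Fin n) (Fin n) ℂ)

theorem block_mul : block A B C D * block A' B' C' D' =
    block (A * A' + B * C') (A * B' + B * D') (C * A' + D * C') (C * B' + D * D') := by
  simp only [block, Matrix.reindex_apply, Matrix.submatrix_mul_equiv, Matrix.fromBlocks_multiply]

theorem block_sub : block A B C D - block A' B' C' D' =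
    block (A - A') (B - B') (C - C') (D - D') := by
  simp only [sub_eq_add_neg, ← Matrix.fromBlocks_add, ← Matrix.fromBlocks_neg, block,
    Matrix.reindex_apply, Matrix.submatrix_add, Matrix.submatrix_neg, Pi.add_apply, Pi.neg_apply]

theorem block_neg : -block A B C D = block (-A) (-B) (-C) (-D) := by
  simp only [block, Matrix.reindex_apply, ← Matrix.fromBlocks_neg, Matrix.submatrix_neg,
    Pi.neg_apply]

theorem block_smul (c : ℂ) : c • block A B C D = block (c • A) (c • B) (c • C) (c • D) := by
  simp only [block, Matrix.reindex_apply, ← Matrix.fromBlocks_smul, Matrix.submatrix_smul,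
    Pi.smul_apply]

theorem block_conjTranspose : (block A B C D)ᴴ = block Aᴴ Cᴴ Bᴴ Dᴴ := by
  simp only [block, Matrix.conjTranspose_reindex, Matrix.fromBlocks_conjTranspose]

theorem block_one : block (1 : Matrix (Fin m) (Fin m) ℂ) 0 0 (1 : Matrix (Fin n) (Fin n) ℂ) = 1 := by
  simp only [block, Matrix.fromBlocks_one, Matrix.reindex_apply, Matrix.submatrix_one_equiv]

theorem block_zero : block (0 : Matrix (Fin m) (Fin m) ℂ) 0 0 (0 : Matrix (Fin n) (Fin n) ℂ) = 0 := by
  simp only [block, Matrix.fromBlocks_zero, Matrix.reindex_apply, Matrix.submatrix_zero,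
    Pi.zero_apply]

variable {A A' B B' C C' D D'} in
theorem block_inj (h : block A B C D = block A' B' C' D') :
    A = A' ∧ B = B' ∧ C = C' ∧ D = D' :=
  Matrix.fromBlocks_inj.1 ((Matrix.reindex _ _).injective h)

end Block

/-- The derivative of a free function at a direct sum, in the off-diagonal direction `X - Y`. -/
theorem fderiv_directSum_offDiag {D : USet d} {F : UMap d e} (hD : IsFreeSet D)
    (hF : IsAnalyticFreeFunction D F) {n : ℕ+} {X Y : MatTuple d n} (hX : X ∈ D n)
    (hY : Y ∈ D n) :
    fderiv ℂ (F (n + n)) (directSum X Y) (fun i => block 0 ((2 : ℂ) • (X i - Y i)) 0 0) =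
      fun i => block 0 ((2 : ℂ) • (F n X i - F n Y i)) 0 0 := by
  -- With `K₁ = [[0, 1], [-1, 0]]` and `K₂ = [[0, i], [i, 0]]`, both skew-Hermitian with square
  -- `-1`, `K₁ - iK₂ = 2E₁₂`.
  have comm : ∀ {k : ℕ} (A B : MatTuple k n),
      (fun i => block 0 ((2 : ℂ) • (A i - B i)) 0 0 : MatTuple k (n + n)) =
      commutator (directSum A B) (block 0 1 (-1) 0) -
        Complex.I • commutator (directSum A B) (block 0 (Complex.I • 1) (Complex.I • 1) 0) := by
    intro k A B
    funext i
    simp only [commutator, directSum_apply, Pi.sub_apply, Pi.smul_apply, block_mul, block_sub,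
      block_smul]
    congr 1 <;> simp [smul_sub, smul_smul, two_smul]
    abel
  have hW := hD.directSum_mem n n X Y hX hY
  have hd := (hF.analytic _ _ hW).differentiableAt
  rw [comm, comm, map_sub, map_smul, ← hF.map_directSum n n X Y hX hY,
    fderiv_commutator hF.toIsFreeFunction hW hd, fderiv_commutator hF.toIsFreeFunction hW hd]
  · rw [block_conjTranspose, block_neg]
    congr 1 <;> simp
  · rw [block_mul, ← block_one, block_neg]
    congr 1 <;> simp [smul_smul]
  · rw [block_conjTranspose, block_neg]
    congr 1 <;> simp
  · rw [block_mul, ← block_one, block_neg]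
    congr 1 <;> simp

/-- Injectivity at size `n` comes from the derivative at size `n + n`, which is why all levels must
be considered together. -/
theorem injOn_of_injective_fderiv {D : USet d} {F : UMap d e} (hD : IsFreeSet D)
    (hF : IsAnalyticFreeFunction D F)
    (hinj : ∀ (n : ℕ+) (X : MatTuple d n), X ∈ D n → Function.Injective (fderiv ℂ (F n) X))
    (n : ℕ+) : Set.InjOn (F n) (D n) := by
  intro X hX Y hY hXY
  have h := fderiv_directSum_offDiag hD hF hX hY
  rw [hXY] at h
  simp only [sub_self, smul_zero, block_zero] at h
  have h0 := hinj _ _ (hD.directSum_mem n n X Y hX hY) (h.trans (map_zero _).symm)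
  funext i
  have hi : block 0 ((2 : ℂ) • (X i - Y i)) 0 0 = block 0 0 0 0 :=
    (congrFun h0 i).trans block_zero.symm
  simpa [sub_eq_zero] using (block_inj hi).2.1

theorem isFreeSet_image {D : USet d} {F : UMap d e} (hD : IsFreeSet D)
    (hF : IsFreeFunction D F) : IsFreeSet (image F D) where
  directSum_mem := by
    rintro m n _ _ ⟨X, hX, rfl⟩ ⟨Y, hY, rfl⟩
    exact ⟨_, hD.directSum_mem m n X Y hX hY, hF.map_directSum m n X Y hX hY⟩
  conj_mem := by
    rintro n _ V hV ⟨X, hX, rfl⟩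
    exact ⟨_, hD.conj_mem n X V hV hX, hF.map_conj n X V hV hX⟩

theorem isFreeFunction_leftInv {D : USet d} {F : UMap d e} {G : UMap e d} (hD : IsFreeSet D)
    (hF : IsFreeFunction D F) (hG : ∀ n, Set.LeftInvOn (G n) (F n) (D n)) :
    IsFreeFunction (image F D) G where
  map_directSum := by
    rintro m n _ _ ⟨X, hX, rfl⟩ ⟨Y, hY, rfl⟩
    rw [← hF.map_directSum m n X Y hX hY, hG _ (hD.directSum_mem m n X Y hX hY), hG m hX, hG n hY]
  map_conj := by
    rintro n _ V hV ⟨X, hX, rfl⟩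
    rw [← hF.map_conj n X V hV hX, hG n (hD.conj_mem n X V hV hX), hG n hX]

theorem bijective_fderiv_of_leftInvOn {D : USet d} {F G : UMap d d} {n : ℕ+}
    (hDo : IsOpen (D n)) {X : MatTuple d n} (hX : X ∈ D n)
    (hF : DifferentiableAt ℂ (F n) X) (hG : DifferentiableAt ℂ (G n) (F n X))
    (hGF : Set.LeftInvOn (G n) (F n) (D n)) : Function.Bijective (fderiv ℂ (F n) X) := by
  have h1 := hG.hasFDerivAt.comp X hF.hasFDerivAt
  have h2 : HasFDerivAt (G n ∘ F n) (ContinuousLinearMap.id ℂ (MatTuple d n)) X := by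
    refine (hasFDerivAt_id X).congr_of_eventuallyEq ?_
    filter_upwards [hDo.mem_nhds hX] with Y hY using hGF hY
  have hinj : Function.Injective (fderiv ℂ (F n) X) := fun H H' h => by
    have key := fun H => DFunLike.congr_fun (h1.unique h2) H
    exact (key H).symm.trans ((congrArg _ h).trans (key H'))
  -- Source and target are the same finite-dimensional space, so a left inverse suffices.
  exact ⟨hinj, LinearMap.injective_iff_surjective (f := (fderiv ℂ (F n) X :
    MatTuple d n →ₗ[ℂ] MatTuple d n)) |>.1 hinj⟩

end FreeAnalysis

theorem mainTheorem6 (d : ℕ) (U : FreeAnalysis.USet d) (F : FreeAnalysis.UMap d d)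
    (hU_free : FreeAnalysis.IsFreeSet U)
    (hU_open : FreeAnalysis.IsOpenLevels U)
    (hU_conn : FreeAnalysis.IsConnectedLevels U)
    (hF : FreeAnalysis.IsAnalyticFreeFunction U F) :
    (∀ (n : ℕ+) (X : FreeAnalysis.MatTuple d n), X ∈ U n →
      Function.Bijective (fun H : FreeAnalysis.MatTuple d n => FreeAnalysis.freeDeriv F X H)) ↔
    FreeAnalysis.HasAnalyticFreeInverse U F := by
  have deriv_eq : ∀ (n : ℕ+) (X : FreeAnalysis.MatTuple d n), X ∈ U n →
      (fun H : FreeAnalysis.MatTuple d n => FreeAnalysis.freeDeriv F X H) = fderiv ℂ (F n) X :=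
    fun n X hX => funext (FreeAnalysis.freeDeriv_eq_fderiv (hF.analytic n X hX).differentiableAt)
  constructor
  · intro h
    have hbij : ∀ (n : ℕ+) (X : FreeAnalysis.MatTuple d n), X ∈ U n →
        Function.Bijective (fderiv ℂ (F n) X) := fun n X hX => deriv_eq n X hX ▸ h n X hX
    have hleft : ∀ n, Set.LeftInvOn (Function.invFunOn (F n) (U n)) (F n) (U n) := fun n =>
      (FreeAnalysis.injOn_of_injective_fderiv hU_free hF
        (fun n X hX => (hbij n X hX).injective) n).leftInvOn_invFunOn
    have hinv := fun n => FreeAnalysis.isOpen_image_and_analyticOnNhd_leftInvOn (hU_open n)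
      (hF.analytic n) (hbij n) (hleft n)
    exact ⟨FreeAnalysis.isFreeSet_image hU_free hF.toIsFreeFunction, fun n => (hinv n).1,
      fun n => Function.invFunOn (F n) (U n),
      ⟨FreeAnalysis.isFreeFunction_leftInv hU_free hF.toIsFreeFunction hleft,
        fun n => (hinv n).2⟩,
      fun n => ⟨hleft n, (hleft n).rightInvOn_image⟩⟩
  · rintro ⟨-, -, G, hG, hGF⟩ n X hX
    rw [deriv_eq n X hX]
    exact FreeAnalysis.bijective_fderiv_of_leftInvOn (hU_open n) hX
      (hF.analytic n X hX).differentiableAt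
      (hG.analytic n _ (Set.mem_image_of_mem _ hX)).differentiableAt (hGF n).1
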